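/- Let $n,m\ge 0$ be integers, $\tau>0$, $T\ge 0$, $w\in\mathbb{R}^m$, and let $f=f(x,y,t;w)$ be an $\mathbb{R}^n$-valued vector field which, for the given $w$, is continuous in $(x,y,t)\in\mathbb{R}^n\times\mathbb{R}^n\times[0,\infty)$ and differentiable in $(x,y)$ with derivative continuous in $(x,y,t)$. Let $\phi:[-\tau,0]\to\mathbb{R}^n$ be continuous and let $h:[-\tau,T]\to\mathbb{R}^n$ be a solution of the delay differential equation $$h'(t)=f(h(t),h(t-\tau),t;w)\quad (0\le t\le T),\qquad h(t)=\phi(t)\quad(-\tau\le t\le 0)$$ (one-sided derivatives at $0$ and $T$). Let $L:\mathbb{R}^n\to\mathbb{R}$ be differentiable at $h(T)$. For $t\in[0,T]$ and $\xi\in\mathbb{R}^n$ let $y^{t,\xi}$ be the trajectory obtained when the state at time $t$ is replaced by $\xi$ and the past is kept: $y^{t,\xi}(s)=h(s)$ for $t-\tau\le s<t$, $y^{t,\xi}(t)=\xi$, and $y^{t,\xi}$ is continuous on $[t,T]$ with right derivative $f(y^{t,\xi}(s),y^{t,\xi}(s-\tau),s;w)$ at each $s\in[t,T)$. The adjoint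 $\lambda(t)=\partial L(h(T))/\partial h(t)$ is the derivative of $\xi\mapsto L(y^{t,\xi}(T))$ at $\xi=h(t)$, its transpose $\lambda(t)^{\top}$ being the row vector of partial derivatives. Then, for every $t\in[0,T]$, $y^{t,\xi}$ exists for all $\xi$ in a neighbourhood of $h(t)$, is unique on $[t-\tau,T]$ whenever it exists, and $\xi\mapsto L(y^{t,\xi}(T))$ is differentiable at $h(t)$, so that $\lambda$ is well defined on $[0,T]$. Moreover $\lambda$ is continuous on $[0,T]$ and satisfies the backward delay differential equation $$\frac{d\lambda(t)^{\top}}{dt}=-\lambda(t)^{\top}\frac{\partial f}{\partial x}\big(h(t),h(t-\tau),t;w\big)-\lambda(t+\tau)^{\top}\frac{\partial f}{\partial y}\big(h(t+\tau),h(t),t+\tau;w\big)\,\chi_{[0,T-\tau]}(t)$$ with terminal condition $\lambda(T)^{\top}=\partial L(h(T))/\partial h(T)$, where $\chi_{[0,T-\tau]}$ is the characteristic function, and the second term is taken to be zero for $t\notin[0,T-\tau]$. The equation holds at every $t\in[0,T]$ with $t\ne T-\tau$ (one-sided derivatives at $0$ and $T$), and at every $t\in(0,T]$, including $t=T-\tau$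 when $T>\tau$, with the left derivative of $\lambda$. -/

import Mathlib

open Set Filter Topology

noncomputable section

namespace NDDE

/-- The state space `ℝⁿ` with its Euclidean norm. -/
abbrev Vec (n : ℕ) : Type := EuclideanSpace ℝ (Fin n)

/-- Standing regularity of a vector field `g (x, y, t)` on `ℝⁿ × ℝⁿ × [0, ∞)`: it is continuous,
it is differentiable in the two states `(x, y)`, and this derivative is continuous in `(x, y, t)`. -/
structure IsC1Field {n : ℕ} (g : Vec n → Vec n → ℝ → Vec n) : Prop where
  continuousOn : ContinuousOn (fun q : (Vec n × Vec n) × ℝ => g q.1.1 q.1.2 q.2) {q | 0 ≤ q.2}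
  differentiable : ∀ t : ℝ, 0 ≤ t → Differentiable ℝ (fun p : Vec n × Vec n => g p.1 p.2 t)
  continuousOn_fderiv : ContinuousOn
    (fun q : (Vec n × Vec n) × ℝ => fderiv ℝ (fun p : Vec n × Vec n => g p.1 p.2 q.2) q.1)
    {q | 0 ≤ q.2}

/-- `h` solves `h'(t) = f (h t, h (t - τ), t; w)` on `[0, T]` with initial function `φ`. -/
structure IsForwardSolution {n m : ℕ} (f : Vec n → Vec n → ℝ → Vec m → Vec n) (w : Vec m)
    (τ T : ℝ) (φ h : ℝ → Vec n) : Prop where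
  initial : ∀ t ∈ Icc (-τ) 0, h t = φ t
  deriv : ∀ t ∈ Icc 0 T, HasDerivWithinAt h (f (h t) (h (t - τ)) t w) (Icc 0 T) t

/-- `y` is the trajectory obtained from `h` by replacing the value of the state at the single time
`t` by `ξ`: the past of `h` on `[t - τ, t)` is kept, `y t = ξ`, and `y` follows the delay equation
on `[t, T]`. As the history may jump at time `t`, the right-hand side may jump at time `t + τ`, so
the equation is required with right derivatives (together with continuity of `y` on `[t, T]`). -/
structure IsRestart {n m : ℕ} (f : Vec n → Vec n → ℝ → Vec m → Vec n) (w : Vec m)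
    (τ T : ℝ) (h : ℝ → Vec n) (t : ℝ) (ξ : Vec n) (y : ℝ → Vec n) : Prop where
  past : ∀ s ∈ Ico (t - τ) t, y s = h s
  start : y t = ξ
  continuousOn : ContinuousOn y (Icc t T)
  deriv : ∀ s ∈ Ico t T, HasDerivWithinAt y (f (y s) (y (s - τ)) s w) (Ici s) s

open Classical in
/-- `L (h(T))` as a function of the value `ξ` of the state at time `t`
(with the value `L 0` if the restarted equation has no solution up to time `T`). -/
def terminalLoss {n m : ℕ} (f : Vec n → Vec n → ℝ → Vec m → Vec n) (w : Vec m)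
    (τ T : ℝ) (L : Vec n → ℝ) (h : ℝ → Vec n) (t : ℝ) (ξ : Vec n) : ℝ :=
  if ex : ∃ y, IsRestart f w τ T h t ξ y then L (ex.choose T) else L 0

/-- The adjoint `∂L(h(T)) / ∂h(t)`, as a covector (the row vector of partial derivatives). -/
def adjoint {n m : ℕ} (f : Vec n → Vec n → ℝ → Vec m → Vec n) (w : Vec m)
    (τ T : ℝ) (L : Vec n → ℝ) (h : ℝ → Vec n) (t : ℝ) : Vec n →L[ℝ] ℝ :=
  fderiv ℝ (terminalLoss f w τ T L h t) (h t)

/-- The Jacobian of `f` in its first (present) state argument at time `t` along `h`. -/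
def jacPresent {n m : ℕ} (f : Vec n → Vec n → ℝ → Vec m → Vec n) (w : Vec m)
    (τ : ℝ) (h : ℝ → Vec n) (t : ℝ) : Vec n →L[ℝ] Vec n :=
  fderiv ℝ (fun x : Vec n => f x (h (t - τ)) t w) (h t)

/-- The Jacobian of `f (h (t + τ), y, t + τ; w)` in the delayed argument `y`, at `y = h t`. -/
def jacDelayed {n m : ℕ} (f : Vec n → Vec n → ℝ → Vec m → Vec n) (w : Vec m)
    (τ : ℝ) (h : ℝ → Vec n) (t : ℝ) : Vec n →L[ℝ] Vec n :=
  fderiv ℝ (fun y : Vec n => f (h (t + τ)) y (t + τ) w) (h t)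

/-- The right-hand side of the backward delay equation for a covector-valued function `p`. -/
def adjointRHS {n m : ℕ} (f : Vec n → Vec n → ℝ → Vec m → Vec n) (w : Vec m)
    (τ T : ℝ) (h : ℝ → Vec n) (p : ℝ → Vec n →L[ℝ] ℝ) (t : ℝ) : Vec n →L[ℝ] ℝ :=
  -((p t).comp (jacPresent f w τ h t))
    - (Icc 0 (T - τ)).indicator (fun s => (p (s + τ)).comp (jacDelayed f w τ h s)) t

end NDDE

end

/-! The argument is by duality, and the variational equation is never solved. The backward equation
is linear. With terminal value `fderiv ℝ L (h T)` it has a solution `p`, obtained by reversing time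
and solving a linear forward delay equation with zero history (`exists_backward_delay_solution`). It
remains to show that `p t` is the derivative of the terminal loss at `h t`.

Let `y` restart at `ξ` and put `δ = y - h`. Then `δ` vanishes before `t`, `δ t = ξ - h t`, and a
Gronwall estimate gives `‖δ‖ ≤ C * ‖ξ - h t‖` (`exists_isRestart_norm_sub_le`). Uniform
differentiability of the field makes `δ` solve the linearized equation up to an error `o(‖ξ - h
t‖)`. When `p s (δ s)` is differentiated, the present terms cancel and the delayed terms form a
difference `J s - J (s + τ)` whose integral is zero. Hence `p T (δ T) = p t (ξ - h t) + o(‖ξ - h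
t‖)` (`abs_apply_sub_apply_le_of_backward_solution`), and differentiability of `L` at `h T` finishes
the proof. -/

namespace NDDE

/-! ### Delay equations in a normed space: method of steps and Gronwall. -/

section General

variable {E : Type*} [NormedAddCommGroup E] [NormedSpace ℝ E]

/-- `y` follows `y' = v (y s) (y (s - τ)) s` on `[t, b]` (with right derivatives), starting from `ξ`
with history `ψ` on `[t - τ, t)`. -/
structure IsDelayTrajectory (v : E → E → ℝ → E) (τ t b : ℝ) (ψ : ℝ → E) (ξ : E) (y : ℝ → E) :
    Prop where
  past : ∀ s ∈ Ico (t - τ) t, y s = ψ s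
  start : y t = ξ
  continuousOn : ContinuousOn y (Icc t b)
  deriv : ∀ s ∈ Ico t b, HasDerivWithinAt y (v (y s) (y (s - τ)) s) (Ici s) s

theorem IsDelayTrajectory.mono {v : E → E → ℝ → E} {τ t b b' : ℝ} {ψ : ℝ → E} {ξ : E} {y : ℝ → E}
    (hy : IsDelayTrajectory v τ t b ψ ξ y) (hb : b' ≤ b) : IsDelayTrajectory v τ t b' ψ ξ y :=
  ⟨hy.past, hy.start, hy.continuousOn.mono (Icc_subset_Icc_right hb),
    fun s hs => hy.deriv s ⟨hs.1, hs.2.trans_le hb⟩⟩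

/-- If `M` bounds the speed at `x₀` and `d = b - a`, then on the ball of radius `2 * M * d` the
speed is at most `M + K * (2 * M * d) ≤ 2 * M`, so solutions cannot leave it. The admissible length
depends on `K` alone, which permits iteration. -/
theorem exists_solution_of_mul_le_half [CompleteSpace E] {v : ℝ → E → E} {K : NNReal} {a b : ℝ}
    (hab : a ≤ b) (hK : K * (b - a) ≤ 1 / 2) (hLip : ∀ s, LipschitzWith K (v s))
    (hcont : ∀ x, ContinuousOn (fun s => v s x) (Icc a b)) (x₀ : E) :
    ∃ z : ℝ → E, z a = x₀ ∧ ∀ s ∈ Icc a b, HasDerivWithinAt z (v s (z s)) (Icc a b) s := by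
  obtain ⟨M, hM⟩ := isCompact_Icc.exists_bound_of_continuousOn (hcont x₀)
  have hM0 : 0 ≤ M := (norm_nonneg _).trans (hM a (left_mem_Icc.2 hab))
  lift M to NNReal using hM0
  obtain ⟨d, hd⟩ : ∃ d : NNReal, (d : ℝ) = b - a := ⟨⟨b - a, sub_nonneg.2 hab⟩, rfl⟩
  have hpl : IsPicardLindelof v (tmin := a) (tmax := b) ⟨a, left_mem_Icc.2 hab⟩ x₀
      (2 * M * d) 0 (M + K * (2 * M * d)) K := by
    refine ⟨fun s _ => (hLip s).lipschitzOnWith, fun x _ => hcont x, fun s hs x hx => ?_, ?_⟩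
    · have h1 := (hLip s).dist_le_mul x x₀
      have h2 : dist x x₀ ≤ 2 * M * d := by simpa using hx
      have h3 : ‖v s x‖ ≤ ‖v s x₀‖ + dist (v s x) (v s x₀) := by
        rw [dist_eq_norm]
        simpa [add_comm] using norm_add_le (v s x - v s x₀) (v s x₀)
      have h4 := hM s hs
      push_cast
      have := mul_le_mul_of_nonneg_left h2 K.2
      simp only [NNReal.val_eq_coe] at this
      linarith
    · have : max (b - a) (a - a) = b - a := max_eq_left (by simpa using hab)
      simp only [this]
      push_cast
      rw [← hd] at hK ⊢
      have := mul_le_mul_of_nonneg_left hK (mul_nonneg M.2 d.2)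
      simp only [NNReal.val_eq_coe] at this
      nlinarith
  obtain ⟨z, hz, hz'⟩ := hpl.exists_eq_forall_mem_Icc_hasDerivWithinAt₀
  exact ⟨z, hz, hz'⟩

/-- Agreement with `g` is asked only on the half-open interval: when `b' = t + τ`, the delayed state
may jump at `b'`, while `g` stays continuous. -/
theorem IsDelayTrajectory.extend {v : E → E → ℝ → E} {τ t b b' : ℝ} {ψ : ℝ → E} {ξ : E}
    {y z g : ℝ → E} (hy : IsDelayTrajectory v τ t b ψ ξ y) (hτ : 0 < τ) (htb : t ≤ b) (hbb : b ≤ b')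
    (hb' : b' ≤ b + τ) (hg : ∀ s ∈ Ico b b', y (s - τ) = g s)
    (hz : z b = y b)
    (hz' : ∀ s ∈ Icc b b', HasDerivWithinAt z (v (z s) (g s) s) (Icc b b') s) :
    ∃ y, IsDelayTrajectory v τ t b' ψ ξ y := by
  obtain ⟨Y, hle, hge⟩ : ∃ Y : ℝ → E, (∀ s ≤ b, Y s = y s) ∧ ∀ s, b ≤ s → Y s = z s := by
    refine ⟨fun s => if s ≤ b then y s else z s, fun s hs => if_pos hs, fun s hs => ?_⟩
    dsimp only
    split_ifs with h
    · rw [le_antisymm h hs, hz]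
    · rfl
  refine ⟨Y, ⟨fun s hs => ?_, ?_, ?_, fun s hs => ?_⟩⟩
  · rw [hle s (hs.2.le.trans htb), hy.past s hs]
  · rw [hle t htb, hy.start]
  · rw [← Icc_union_Icc_eq_Icc htb hbb]
    refine ContinuousOn.union_of_isClosed ?_ ?_ isClosed_Icc isClosed_Icc
    · exact hy.continuousOn.congr fun s hs => hle s hs.2
    · exact ContinuousOn.congr (fun s hs => (hz' s hs).continuousWithinAt) fun s hs => hge s hs.1
  · rcases lt_or_ge s b with h | h
    · rw [hle s h.le, hle (s - τ) (by linarith)]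
      refine (hy.deriv s ⟨hs.1, h⟩).congr_of_eventuallyEq ?_ (hle s h.le)
      filter_upwards [mem_nhdsWithin_of_mem_nhds (Iio_mem_nhds h)] with r hr
      exact hle r (le_of_lt hr)
    · rw [hge s h, hle (s - τ) (by linarith [hs.2]), hg s ⟨h, hs.2⟩]
      have h1 : HasDerivWithinAt z (v (z s) (g s) s) (Ici s) s :=
        (hz' s ⟨h, hs.2.le⟩).mono_of_mem_nhdsWithin <|
          mem_of_superset (Icc_mem_nhdsGE hs.2) (Icc_subset_Icc_left h)
      exact h1.congr (fun r hr => hge r (h.trans hr)) (hge s h)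

/-- Method of steps with `d = τ / N`. As `t + τ` is a grid point, the delayed term on each step
comes either wholly from `ψ` or wholly from the part of `y` already built, so each step is an
ordinary differential equation. -/
theorem exists_isDelayTrajectory [CompleteSpace E] {v : E → E → ℝ → E} {K : NNReal}
    (hv : Continuous fun q : (E × E) × ℝ => v q.1.1 q.1.2 q.2)
    (hLip : ∀ y s, LipschitzWith K fun x => v x y s) {τ : ℝ} (hτ : 0 < τ) {t : ℝ} {ψ : ℝ → E}
    (hψ : ContinuousOn ψ (Icc (t - τ) t)) (ξ : E) (b : ℝ) :
    ∃ y, IsDelayTrajectory v τ t b ψ ξ y := by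
  obtain ⟨N, hN⟩ := exists_nat_gt (2 * K * τ)
  have hN0 : (0 : ℝ) < N := lt_of_le_of_lt (by positivity) hN
  obtain ⟨d, hd⟩ : ∃ d, d = τ / N := ⟨_, rfl⟩
  have hd0 : 0 < d := hd ▸ div_pos hτ hN0
  have hNd : N * d = τ := by rw [hd]; field_simp
  have hKd : K * d ≤ 1 / 2 := by
    rw [hd, ← mul_div_assoc, div_le_div_iff₀ hN0 two_pos]
    linarith
  have hN1 : (1 : ℝ) ≤ N := by exact_mod_cast Nat.one_le_iff_ne_zero.2 (by rintro rfl; simp at hN0)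
  have hdτ : d ≤ τ := by rw [← hNd]; nlinarith
  have key : ∀ k : ℕ, ∃ y, IsDelayTrajectory v τ t (t + k * d) ψ ξ y := by
    intro k
    induction k with
    | zero =>
      refine ⟨fun s => if s < t then ψ s else ξ, ⟨fun s hs => if_pos hs.2, by simp, ?_, ?_⟩⟩
      · simp
      · simp
    | succ k ih =>
      obtain ⟨y, hy⟩ := ih
      have hkd : 0 ≤ k * d := by positivity
      have hstep : (t + (k + 1 : ℕ) * d) - (t + k * d) = d := by push_cast; ring
      obtain ⟨g, hg, hgy⟩ : ∃ g : ℝ → E, ContinuousOn g (Icc (t + k * d) (t + (k + 1 : ℕ) * d)) ∧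
          ∀ s ∈ Ico (t + k * d) (t + (k + 1 : ℕ) * d), y (s - τ) = g s := by
        rcases lt_or_ge k N with hk | hk
        · have hk' : ((k + 1 : ℕ) : ℝ) * d ≤ N * d := by gcongr; exact hk
          refine ⟨fun s => ψ (s - τ), hψ.comp (by fun_prop) fun s hs => ?_, fun s hs => ?_⟩
          · constructor <;> linarith [hs.1, hs.2]
          · refine hy.past _ ?_
            constructor <;> linarith [hs.1, hs.2]
        · have hk' : (N : ℝ) * d ≤ k * d := by gcongr
          refine ⟨fun s => y (s - τ), hy.continuousOn.comp (by fun_prop) fun s hs => ?_,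
            fun s _ => rfl⟩
          constructor <;> linarith [hs.1, hs.2]
      obtain ⟨z, hz, hz'⟩ := exists_solution_of_mul_le_half (v := fun s x => v x (g s) s) (K := K)
        (a := t + k * d) (b := t + (k + 1 : ℕ) * d) (by linarith) (by rw [hstep]; exact hKd)
        (fun s => hLip _ _)
        (fun x => hv.comp_continuousOn ((continuousOn_const.prodMk hg).prodMk continuousOn_id))
        (y (t + k * d))
      exact hy.extend hτ (by linarith) (by linarith) (by linarith) hgy hz hz'
  obtain ⟨k, hk⟩ := exists_nat_gt ((b - t) / d)
  obtain ⟨y, hy⟩ := key k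
  refine ⟨y, hy.mono ?_⟩
  rw [div_lt_iff₀ hd0] at hk
  linarith

/-- At a first contact of `‖δ‖` with the barrier `C * exp ((2 * K + 1) * (s - t))`, both the present
and the delayed norm are at most the barrier, so the speed is at most `2 * K` times it, strictly
below the barrier's slope. Induction over steps of length `τ` controls the delayed norm. -/
theorem norm_le_exp_of_norm_deriv_right_le_delay {δ δ' : ℝ → E} {τ t T K : ℝ} (hτ : 0 < τ)
    (hK : 0 ≤ K) (hpast : ∀ s ∈ Ico (t - τ) t, δ s = 0) (hc : ContinuousOn δ (Icc t T))
    (hd : ∀ s ∈ Ico t T, HasDerivWithinAt δ (δ' s) (Ici s) s)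
    (hb : ∀ s ∈ Ico t T, ‖δ' s‖ ≤ K * (‖δ s‖ + ‖δ (s - τ)‖)) :
    ∀ s ∈ Icc t T, ‖δ s‖ ≤ ‖δ t‖ * Real.exp ((2 * K + 1) * (s - t)) := by
  have main : ∀ C > 0, ‖δ t‖ ≤ C → ∀ k : ℕ, ∀ s ∈ Icc t T, s ≤ t + k * τ →
      ‖δ s‖ ≤ C * Real.exp ((2 * K + 1) * (s - t)) := by
    intro C hC htC k
    induction k with
    | zero =>
      intro s hs hst
      obtain rfl : s = t := le_antisymm (by simpa using hst) hs.1
      simpa using htC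
    | succ k ih =>
      intro s hs hst
      have hB : ∀ r, HasDerivAt (fun r => C * Real.exp ((2 * K + 1) * (r - t)))
          ((2 * K + 1) * (C * Real.exp ((2 * K + 1) * (r - t)))) r := by
        intro r
        have h1 : HasDerivAt (fun r => (2 * K + 1) * (r - t)) (2 * K + 1) r := by
          simpa using ((hasDerivAt_id r).sub_const t).const_mul (2 * K + 1)
        exact (h1.exp.const_mul C).congr_deriv (by ring)
      refine image_norm_le_of_norm_deriv_right_lt_deriv_boundary (a := t) (b := s)
        (hc.mono (Icc_subset_Icc_right hs.2)) (fun r hr => hd r ⟨hr.1, hr.2.trans_le hs.2⟩)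
        (by simpa using htC) hB ?_ (right_mem_Icc.2 hs.1)
      intro r hr hreq
      have hpos : 0 < C * Real.exp ((2 * K + 1) * (r - t)) := by positivity
      have hdel : ‖δ (r - τ)‖ ≤ C * Real.exp ((2 * K + 1) * (r - t)) := by
        rcases lt_or_ge (r - τ) t with h | h
        · rw [hpast _ ⟨by linarith [hr.1], h⟩, norm_zero]
          exact hpos.le
        · push_cast at hst
          refine (ih (r - τ) ⟨h, by linarith [hr.2, hs.2]⟩ (by linarith [hr.2])).trans ?_
          gcongr
          linarith
      have h2 := hb r ⟨hr.1, hr.2.trans_le hs.2⟩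
      rw [hreq] at h2
      have h3 := mul_le_mul_of_nonneg_left hdel hK
      linarith
  intro s hs
  obtain ⟨k, hk⟩ := exists_nat_gt ((s - t) / τ)
  rw [div_lt_iff₀ hτ] at hk
  -- Strictness needs `C > 0`, so `‖δ t‖` is enlarged by `ε`, which then tends to zero.
  have h0 : ∀ ε > 0, ‖δ s‖ ≤ (‖δ t‖ + ε) * Real.exp ((2 * K + 1) * (s - t)) := fun ε hε =>
    main _ (by positivity) (by linarith) k s hs (by linarith)
  have hlim : Tendsto (fun ε => (‖δ t‖ + ε) * Real.exp ((2 * K + 1) * (s - t))) (𝓝[>] 0)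
      (𝓝 ((‖δ t‖ + 0) * Real.exp ((2 * K + 1) * (s - t)))) :=
    ((by fun_prop : Continuous fun ε : ℝ => (‖δ t‖ + ε) * Real.exp ((2 * K + 1) * (s - t))).tendsto
      0).mono_left nhdsWithin_le_nhds
  rw [add_zero] at hlim
  exact ge_of_tendsto hlim (eventually_mem_nhdsWithin.mono h0)

end General

/-! ### Truncation by clamping coordinates. -/

theorem exists_lipschitz_retraction (n : ℕ) (R : ℝ) :
    ∃ (c : Vec n → Vec n) (R' : ℝ), LipschitzWith 1 c ∧ (∀ x, ‖c x‖ ≤ R') ∧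
      ∀ x, ‖x‖ ≤ R → c x = x := by
  refine ⟨fun x => WithLp.toLp 2 fun i => max (-R) (min R (x i)), √(∑ _i : Fin n, R ^ 2), ?_, ?_, ?_⟩
  · refine LipschitzWith.of_dist_le_mul fun x y => ?_
    rw [NNReal.coe_one, one_mul, EuclideanSpace.dist_eq, EuclideanSpace.dist_eq]
    refine Real.sqrt_le_sqrt (Finset.sum_le_sum fun i _ => ?_)
    refine pow_le_pow_left₀ dist_nonneg ?_ 2
    rw [Real.dist_eq, Real.dist_eq]
    refine (abs_max_sub_max_le_max _ _ _ _).trans (max_le (by simp) ?_)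
    exact (abs_min_sub_min_le_max _ _ _ _).trans (max_le (by simp) le_rfl)
  · intro x
    rw [EuclideanSpace.norm_eq]
    by_cases hR : 0 ≤ R
    · refine Real.sqrt_le_sqrt (Finset.sum_le_sum fun i _ => ?_)
      refine pow_le_pow_left₀ (norm_nonneg _) ?_ 2
      rw [Real.norm_eq_abs, abs_le]
      exact ⟨le_max_left _ _, max_le (by linarith) (min_le_left _ _)⟩
    · refine Real.sqrt_le_sqrt (Finset.sum_le_sum fun i _ => ?_)
      have h1 : max (-R) (min R (x i)) = -R :=
        max_eq_left ((min_le_left _ _).trans (by linarith))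
      simp only [h1, Real.norm_eq_abs, sq_abs, neg_sq, le_refl]
  · intro x hx
    ext i
    have h1 := abs_le.1 ((PiLp.norm_apply_le x i).trans hx)
    simp only [min_eq_right h1.2, max_eq_right h1.1]

/-! ### Estimates for the field, uniform on compact sets. -/

section Field

variable {n : ℕ} {g : Vec n → Vec n → ℝ → Vec n}

theorem IsC1Field.exists_lipschitz (hg : IsC1Field g) (R T : ℝ) :
    ∃ K : NNReal, ∀ s ∈ Icc 0 T, ∀ x x' y y', ‖x‖ ≤ R → ‖x'‖ ≤ R → ‖y‖ ≤ R → ‖y'‖ ≤ R →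
      ‖g x y s - g x' y' s‖ ≤ K * (‖x - x'‖ + ‖y - y'‖) := by
  have hcomp : IsCompact ((Metric.closedBall (0 : Vec n) R ×ˢ Metric.closedBall (0 : Vec n) R) ×ˢ
      Icc (0 : ℝ) T) :=
    ((isCompact_closedBall _ _).prod (isCompact_closedBall _ _)).prod isCompact_Icc
  obtain ⟨K, hK⟩ := hcomp.exists_bound_of_continuousOn
    (hg.continuousOn_fderiv.mono fun q hq => hq.2.1)
  refine ⟨K.toNNReal, fun s hs x x' y y' hx hx' hy hy' => ?_⟩
  have hball : ∀ z : Vec n, ‖z‖ ≤ R → z ∈ Metric.closedBall (0 : Vec n) R := fun z hz => by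
    simpa using hz
  have h1 := Convex.norm_image_sub_le_of_norm_fderiv_le (𝕜 := ℝ)
    (f := fun p : Vec n × Vec n => g p.1 p.2 s) (C := K.toNNReal)
    (s := Metric.closedBall (0 : Vec n) R ×ˢ Metric.closedBall (0 : Vec n) R)
    (x := (x', y')) (y := (x, y)) (fun p _ => hg.differentiable s hs.1 p)
    (fun p hp => (hK (p, s) ⟨hp, hs⟩).trans (Real.le_coe_toNNReal K))
    ((convex_closedBall _ _).prod (convex_closedBall _ _)) ⟨hball _ hx', hball _ hy'⟩
    ⟨hball _ hx, hball _ hy⟩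
  refine h1.trans (mul_le_mul_of_nonneg_left ?_ K.toNNReal.2)
  rw [Prod.mk_sub_mk, Prod.norm_mk]
  exact max_le_add_of_nonneg (norm_nonneg _) (norm_nonneg _)

theorem IsC1Field.exists_remainder_le (hg : IsC1Field g) (R T : ℝ) {ε : ℝ} (hε : 0 < ε) :
    ∃ η > 0, ∀ s ∈ Icc 0 T, ∀ x x' y y', ∀ r ≤ η, ‖x‖ ≤ R → ‖y‖ ≤ R → ‖x' - x‖ ≤ r →
      ‖y' - y‖ ≤ r → ‖g x' y' s - g x y s
        - fderiv ℝ (fun p : Vec n × Vec n => g p.1 p.2 s) (x, y) (x' - x, y' - y)‖ ≤ ε * r := by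
  have hcomp : IsCompact ((Metric.closedBall (0 : Vec n) (R + 1) ×ˢ
      Metric.closedBall (0 : Vec n) (R + 1)) ×ˢ Icc (0 : ℝ) T) :=
    ((isCompact_closedBall _ _).prod (isCompact_closedBall _ _)).prod isCompact_Icc
  have huc := hcomp.uniformContinuousOn_of_continuous
    (hg.continuousOn_fderiv.mono fun q hq => hq.2.1)
  obtain ⟨η, hη, hηD⟩ := Metric.uniformContinuousOn_iff.1 huc ε hε
  -- The `1` keeps the ball around `(x, y)` inside radius `R + 1`; the half gives the strict
  -- inequality for uniform continuity.
  refine ⟨min (η / 2) 1, by positivity, fun s hs x x' y y' r hr hx hy hxx hyy => ?_⟩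
  have hr0 : 0 ≤ r := (norm_nonneg _).trans hxx
  have hr1 : r ≤ 1 := hr.trans (min_le_right _ _)
  have hr2 : r < η := lt_of_le_of_lt (hr.trans (min_le_left _ _)) (half_lt_self hη)
  have hmem : ∀ p ∈ Metric.closedBall (x, y) r, ((p, s) : (Vec n × Vec n) × ℝ) ∈
      (Metric.closedBall (0 : Vec n) (R + 1) ×ˢ Metric.closedBall (0 : Vec n) (R + 1)) ×ˢ
        Icc (0 : ℝ) T := by
    rintro ⟨u, v⟩ hp
    rw [Metric.mem_closedBall, Prod.dist_eq, max_le_iff] at hp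
    refine ⟨⟨?_, ?_⟩, hs⟩
    · rw [mem_closedBall_zero_iff]
      have := norm_le_norm_add_norm_sub' u x
      rw [← dist_eq_norm] at this
      linarith [hp.1]
    · rw [mem_closedBall_zero_iff]
      have := norm_le_norm_add_norm_sub' v y
      rw [← dist_eq_norm] at this
      linarith [hp.2]
  have h1 := Convex.norm_image_sub_le_of_norm_hasFDerivWithin_le'
    (f := fun p : Vec n × Vec n => g p.1 p.2 s) (C := ε)
    (φ := fderiv ℝ (fun p : Vec n × Vec n => g p.1 p.2 s) (x, y))
    (s := Metric.closedBall (x, y) r) (x := (x, y)) (y := (x', y'))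
    (fun p _ => (hg.differentiable s hs.1 p).hasFDerivAt.hasFDerivWithinAt)
    (fun p hp => by
      have h2 := hηD (p, s) (hmem p hp) ((x, y), s) (hmem _ (Metric.mem_closedBall_self hr0))
        (by rw [Prod.dist_eq, dist_self, max_lt_iff]; exact ⟨lt_of_le_of_lt hp hr2, hη⟩)
      rw [dist_eq_norm] at h2
      exact h2.le)
    (convex_closedBall _ _) (Metric.mem_closedBall_self hr0)
    (by rw [Metric.mem_closedBall, Prod.dist_eq, dist_eq_norm, dist_eq_norm]
        exact max_le hxx hyy)
  rw [Prod.mk_sub_mk, Prod.norm_mk] at h1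
  exact h1.trans (mul_le_mul_of_nonneg_left (max_le hxx hyy) hε.le)

end Field

/-! ### Restarted trajectories and the Jacobians along `h`. -/

section Restart

variable {n m : ℕ} {f : Vec n → Vec n → ℝ → Vec m → Vec n} {w : Vec m} {τ T : ℝ} {φ h : ℝ → Vec n}

theorem IsForwardSolution.continuousOn (hh : IsForwardSolution f w τ T φ h)
    (hφ : ContinuousOn φ (Icc (-τ) 0)) (hτ : 0 < τ) (hT : 0 ≤ T) : ContinuousOn h (Icc (-τ) T) := by
  rw [← Icc_union_Icc_eq_Icc (neg_nonpos.2 hτ.le) hT]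
  exact (hφ.congr hh.initial).union_of_isClosed (fun s hs => (hh.deriv s hs).continuousWithinAt)
    isClosed_Icc isClosed_Icc

theorem IsForwardSolution.hasDerivWithinAt_Ici (hh : IsForwardSolution f w τ T φ h) {s : ℝ}
    (hs : s ∈ Ico 0 T) : HasDerivWithinAt h (f (h s) (h (s - τ)) s w) (Ici s) s :=
  (hh.deriv s ⟨hs.1, hs.2.le⟩).mono_of_mem_nhdsWithin <|
    mem_of_superset (Icc_mem_nhdsGE hs.2) (Icc_subset_Icc_left hs.1)

/-- Clamping states and time makes the field globally Lipschitz in the state, so the truncated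
equation is solvable up to `T`. If `C * ‖ξ - h t‖ ≤ 1`, Gronwall keeps `y` within distance one of
`h`, where the truncation is invisible. -/
theorem exists_isRestart_norm_sub_le (hf : IsC1Field fun x y t => f x y t w)
    (hh : IsForwardSolution f w τ T φ h) (hc : ContinuousOn h (Icc (-τ) T)) (hτ : 0 < τ)
    (hT : 0 ≤ T) :
    ∃ C > 0, ∀ t ∈ Icc 0 T, ∀ ξ, C * ‖ξ - h t‖ ≤ 1 → ∃ y, IsRestart f w τ T h t ξ y ∧
      ∀ s ∈ Icc t T, ‖y s - h s‖ ≤ C * ‖ξ - h t‖ := by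
  obtain ⟨M, hM⟩ := isCompact_Icc.exists_bound_of_continuousOn hc
  obtain ⟨c, R, hcl, hcR, hcM⟩ := exists_lipschitz_retraction n (M + 1)
  obtain ⟨K, hK⟩ := hf.exists_lipschitz R T
  have hcdist : ∀ x y, ‖c x - c y‖ ≤ ‖x - y‖ := fun x y => by
    simpa [dist_eq_norm] using hcl.dist_le_mul x y
  refine ⟨Real.exp ((2 * K + 1) * T), Real.exp_pos _, fun t ht ξ hξ => ?_⟩
  obtain ⟨y, hy⟩ := exists_isDelayTrajectory (K := K)
    (v := fun x y s => f (c x) (c y) (projIcc 0 T hT s) w) (t := t) (ψ := h)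
    (hf.continuousOn.comp_continuous
      (f := fun q : (Vec n × Vec n) × ℝ => ((c q.1.1, c q.1.2), (projIcc 0 T hT q.2 : ℝ)))
      (by have := hcl.continuous; fun_prop) fun q => (projIcc 0 T hT q.2).2.1)
    (fun y s => LipschitzWith.of_dist_le_mul fun x x' => by
      have h1 := hK _ (projIcc 0 T hT s).2 (c x) (c x') (c y) (c y) (hcR _) (hcR _) (hcR _) (hcR _)
      rw [sub_self, norm_zero, add_zero] at h1
      rw [dist_eq_norm, dist_eq_norm]
      exact h1.trans (mul_le_mul_of_nonneg_left (hcdist _ _) K.2)) hτ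
    (hc.mono (Icc_subset_Icc (by linarith [ht.1]) ht.2)) ξ T
  have hhc : ∀ s ∈ Icc (-τ) T, c (h s) = h s := fun s hs => hcM _ (by linarith [hM s hs])
  have hδ := norm_le_exp_of_norm_deriv_right_le_delay (δ := fun s => y s - h s) (T := T) hτ K.coe_nonneg
    (fun s hs => by simp only [hy.past s hs, sub_self])
    (hy.continuousOn.sub (hc.mono (Icc_subset_Icc_left (by linarith [ht.1]))))
    (fun s hs => (hy.deriv s hs).sub (hh.hasDerivWithinAt_Ici ⟨ht.1.trans hs.1, hs.2⟩))
    (fun s hs => by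
      have hs0 : s ∈ Icc 0 T := ⟨ht.1.trans hs.1, hs.2.le⟩
      have h1 := hK s hs0 (c (y s)) (c (h s)) (c (y (s - τ))) (c (h (s - τ))) (hcR _) (hcR _)
        (hcR _) (hcR _)
      simp only [projIcc_of_mem hT hs0]
      rw [hhc s ⟨by linarith [hs0.1], hs0.2⟩,
        hhc (s - τ) ⟨by linarith [hs0.1], by linarith [hs0.2]⟩] at h1
      refine h1.trans (mul_le_mul_of_nonneg_left (add_le_add ?_ ?_) K.2)
      · simpa only [hhc s ⟨by linarith [hs0.1], hs0.2⟩] using hcdist (y s) (h s)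
      · simpa only [hhc (s - τ) ⟨by linarith [hs0.1], by linarith [hs0.2]⟩] using
          hcdist (y (s - τ)) (h (s - τ)))
  have hbound : ∀ s ∈ Icc t T, ‖y s - h s‖ ≤ Real.exp ((2 * K + 1) * T) * ‖ξ - h t‖ := by
    intro s hs
    have h1 := hδ s hs
    simp only [hy.start] at h1
    rw [mul_comm] at h1
    refine h1.trans (mul_le_mul_of_nonneg_right (Real.exp_le_exp.2 ?_) (norm_nonneg _))
    exact mul_le_mul_of_nonneg_left (by linarith [hs.2, ht.1]) (by positivity)
  have hyc : ∀ s ∈ Icc (t - τ) T, c (y s) = y s := by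
    intro s hs
    rcases lt_or_ge s t with h1 | h1
    · rw [hy.past s ⟨hs.1, h1⟩, hhc s ⟨by linarith [hs.1, ht.1], hs.2⟩]
    · refine hcM _ ?_
      have h2 := norm_le_norm_add_norm_sub' (y s) (h s)
      linarith [hbound s ⟨h1, hs.2⟩, hM s ⟨by linarith [ht.1], hs.2⟩]
  refine ⟨y, ⟨hy.past, hy.start, hy.continuousOn, fun s hs => ?_⟩, hbound⟩
  have h1 := hy.deriv s hs
  rwa [hyc s ⟨by linarith [hs.1], hs.2.le⟩, hyc (s - τ) ⟨by linarith [hs.1], by linarith [hs.2]⟩,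
    projIcc_of_mem hT ⟨ht.1.trans hs.1, hs.2.le⟩] at h1

theorem IsRestart.eqOn (hf : IsC1Field fun x y t => f x y t w) (hc : ContinuousOn h (Icc (-τ) T))
    (hτ : 0 < τ) {t : ℝ} (ht : t ∈ Icc 0 T) {ξ : Vec n} {y z : ℝ → Vec n}
    (hy : IsRestart f w τ T h t ξ y) (hz : IsRestart f w τ T h t ξ z) :
    EqOn y z (Icc (t - τ) T) := by
  obtain ⟨M, hM⟩ := isCompact_Icc.exists_bound_of_continuousOn hc
  have hbdd : ∀ u, IsRestart f w τ T h t ξ u → ∃ R, ∀ s ∈ Icc (t - τ) T, ‖u s‖ ≤ R := by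
    intro u hu
    obtain ⟨R, hR⟩ := isCompact_Icc.exists_bound_of_continuousOn hu.continuousOn
    refine ⟨max M R, fun s hs => ?_⟩
    rcases lt_or_ge s t with h1 | h1
    · rw [hu.past s ⟨hs.1, h1⟩]
      exact (hM s ⟨by linarith [hs.1, ht.1], hs.2⟩).trans (le_max_left _ _)
    · exact (hR s ⟨h1, hs.2⟩).trans (le_max_right _ _)
  obtain ⟨R₁, hR₁⟩ := hbdd y hy
  obtain ⟨R₂, hR₂⟩ := hbdd z hz
  obtain ⟨K, hK⟩ := hf.exists_lipschitz (max R₁ R₂) T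
  have hδ := norm_le_exp_of_norm_deriv_right_le_delay (δ := fun s => y s - z s) (T := T) hτ K.coe_nonneg
    (fun s hs => by simp only [hy.past s hs, hz.past s hs, sub_self])
    (hy.continuousOn.sub hz.continuousOn) (fun s hs => (hy.deriv s hs).sub (hz.deriv s hs))
    (fun s hs => by
      have h1 : s ∈ Icc (t - τ) T := ⟨by linarith [hs.1], hs.2.le⟩
      have h2 : s - τ ∈ Icc (t - τ) T := ⟨by linarith [hs.1], by linarith [hs.2]⟩
      exact hK s ⟨ht.1.trans hs.1, hs.2.le⟩ _ _ _ _ ((hR₁ s h1).trans (le_max_left _ _))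
        ((hR₂ s h1).trans (le_max_right _ _)) ((hR₁ _ h2).trans (le_max_left _ _))
        ((hR₂ _ h2).trans (le_max_right _ _)))
  intro s hs
  rcases lt_or_ge s t with h1 | h1
  · rw [hy.past s ⟨hs.1, h1⟩, hz.past s ⟨hs.1, h1⟩]
  · have h2 := hδ s ⟨h1, hs.2⟩
    rw [hy.start, hz.start, sub_self, norm_zero, zero_mul] at h2
    exact sub_eq_zero.1 (norm_le_zero_iff.1 h2)

theorem terminalLoss_eq (hf : IsC1Field fun x y t => f x y t w)
    (hc : ContinuousOn h (Icc (-τ) T)) (hτ : 0 < τ) {t : ℝ} (ht : t ∈ Icc 0 T) {ξ : Vec n}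
    {y : ℝ → Vec n} (L : Vec n → ℝ) (hy : IsRestart f w τ T h t ξ y) :
    terminalLoss f w τ T L h t ξ = L (y T) := by
  have ex : ∃ y, IsRestart f w τ T h t ξ y := ⟨y, hy⟩
  rw [terminalLoss, dif_pos ex,
    ex.choose_spec.eqOn hf hc hτ ht hy (right_mem_Icc.2 (by linarith [ht.2]))]

theorem fderiv_present_and_delayed (hf : IsC1Field fun x y t => f x y t w) {s : ℝ} (hs : 0 ≤ s)
    (x y : Vec n) :
    fderiv ℝ (fun x' => f x' y s w) x = (fderiv ℝ (fun p : Vec n × Vec n => f p.1 p.2 s w)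
      (x, y)).comp (ContinuousLinearMap.inl ℝ (Vec n) (Vec n)) ∧
    fderiv ℝ (fun y' => f x y' s w) y = (fderiv ℝ (fun p : Vec n × Vec n => f p.1 p.2 s w)
      (x, y)).comp (ContinuousLinearMap.inr ℝ (Vec n) (Vec n)) := by
  have hD := (hf.differentiable s hs (x, y)).hasFDerivAt
  exact ⟨(hD.comp (f := fun x' => (x', y)) x (hasFDerivAt_prodMk_left x y)).fderiv,
    (hD.comp (f := fun y' => (x, y')) y (hasFDerivAt_prodMk_right x y)).fderiv⟩

theorem fderiv_apply_eq_jac (hf : IsC1Field fun x y t => f x y t w) {s : ℝ} (hs : 0 ≤ s)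
    (a b : Vec n) :
    fderiv ℝ (fun p : Vec n × Vec n => f p.1 p.2 s w) (h s, h (s - τ)) (a, b) =
      jacPresent f w τ h s a + jacDelayed f w τ h (s - τ) b := by
  rw [jacPresent, jacDelayed, sub_add_cancel, (fderiv_present_and_delayed hf hs _ _).1,
    (fderiv_present_and_delayed hf hs _ _).2, ContinuousLinearMap.comp_apply,
    ContinuousLinearMap.comp_apply, ← map_add]
  simp

theorem continuousOn_jac (hf : IsC1Field fun x y t => f x y t w)
    (hc : ContinuousOn h (Icc (-τ) T)) (hτ : 0 < τ) :
    ContinuousOn (jacPresent f w τ h) (Icc 0 T) ∧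
      ContinuousOn (fun s => jacDelayed f w τ h (s - τ)) (Icc 0 T) := by
  have hD : ContinuousOn (fun s => fderiv ℝ (fun p : Vec n × Vec n => f p.1 p.2 s w)
      (h s, h (s - τ))) (Icc 0 T) := by
    refine hf.continuousOn_fderiv.comp (f := fun s => ((h s, h (s - τ)), s)) ?_ fun s hs => hs.1
    refine ((hc.mono (Icc_subset_Icc_left (by linarith))).prodMk
      (hc.comp (by fun_prop) fun s hs => ?_)).prodMk continuousOn_id
    constructor <;> linarith [hs.1, hs.2]
  constructor
  · refine (hD.clm_comp continuousOn_const).congr fun s hs =>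
      (fderiv_present_and_delayed hf hs.1 _ _).1
  · refine (hD.clm_comp (continuousOn_const (c := ContinuousLinearMap.inr ℝ (Vec n) (Vec n)))).congr
      fun s hs => ?_
    rw [jacDelayed, sub_add_cancel]
    exact (fderiv_present_and_delayed hf hs.1 _ _).2

end Restart

/-! ### The backward equation and its pairing with perturbations. -/

open MeasureTheory in
theorem exists_backward_delay_solution {E : Type*} [NormedAddCommGroup E] [NormedSpace ℝ E]
    {A B : ℝ → E →L[ℝ] E} {τ T : ℝ} (hτ : 0 < τ) (hT : 0 ≤ T) (hA : ContinuousOn A (Icc 0 T))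
    (hB : ContinuousOn (fun s => B (s - τ)) (Icc 0 T)) (ℓ : E →L[ℝ] ℝ) :
    ∃ p p' : ℝ → E →L[ℝ] ℝ, p T = ℓ ∧ ContinuousOn p (Icc 0 T) ∧
      (∀ t ∈ Icc 0 T, p' t = -((p t).comp (A t)) -
        (Icc 0 (T - τ)).indicator (fun s => (p (s + τ)).comp (B s)) t) ∧
      (∀ t ∈ Icc 0 T, t ≠ T - τ → HasDerivWithinAt p (p' t) (Icc 0 T) t) ∧
      ∀ t ∈ Ioc 0 T, HasDerivWithinAt p (p' t) (Iic t) t := by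
  obtain ⟨K, hK⟩ := isCompact_Icc.exists_bound_of_continuousOn hA
  -- Clamping makes the coefficients continuous on all of `ℝ`; the delayed one still equals `B (T -
  -- s)` for `s ∈ Icc τ T`.
  set P : ℝ → ℝ := fun s => projIcc 0 T hT s with hP
  have hPc : Continuous P := by fun_prop
  have hPm : ∀ s, P s ∈ Icc 0 T := fun s => (projIcc 0 T hT s).2
  have hPe : ∀ s ∈ Icc 0 T, P s = s := fun s hs => by simp only [hP, projIcc_of_mem hT hs]
  have hAc : Continuous fun s => A (P (T - s)) :=
    hA.comp_continuous (by fun_prop) fun s => hPm _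
  have hBc : Continuous fun s => B (P (T - s + τ) - τ) :=
    hB.comp_continuous (f := fun s => P (T - s + τ)) (by fun_prop) fun s => hPm _
  obtain ⟨q, hq⟩ := exists_isDelayTrajectory (K := K.toNNReal)
    (v := fun (x y : E →L[ℝ] ℝ) s => x.comp (A (P (T - s))) + y.comp (B (P (T - s + τ) - τ)))
    (by
      refine Continuous.add ?_ ?_
      · exact (by fun_prop : Continuous fun q : ((E →L[ℝ] ℝ) × (E →L[ℝ] ℝ)) × ℝ => q.1.1).clm_comp
          (hAc.comp continuous_snd)
      · exact (by fun_prop : Continuous fun q : ((E →L[ℝ] ℝ) × (E →L[ℝ] ℝ)) × ℝ => q.1.2).clm_comp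
          (hBc.comp continuous_snd))
    (fun y s => LipschitzWith.of_dist_le_mul fun x x' => by
      rw [dist_add_right, dist_eq_norm, dist_eq_norm, ← ContinuousLinearMap.sub_comp, mul_comm]
      refine (ContinuousLinearMap.opNorm_comp_le _ _).trans ?_
      exact mul_le_mul_of_nonneg_left ((hK _ (hPm _)).trans (Real.le_coe_toNNReal K))
        (norm_nonneg _))
    hτ (t := 0) (ψ := fun _ => 0) continuousOn_const ℓ T
  -- Zero history produces the characteristic function by itself. In reversed time the only possible
  -- jump of `H` is at `s = τ`, that is, at `t = T - τ`.
  set G₂ : ℝ → E →L[ℝ] ℝ := fun s => (q (s - τ)).comp (B (P (T - s + τ) - τ)) with hG₂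
  set H : ℝ → E →L[ℝ] ℝ := fun s => (q s).comp (A (P (T - s))) + (Icc τ T).indicator G₂ s with hH
  have hvH : ∀ s ∈ Icc 0 T,
      (q s).comp (A (P (T - s))) + (q (s - τ)).comp (B (P (T - s + τ) - τ)) = H s := by
    intro s hs
    simp only [hH, add_right_inj]
    by_cases h : τ ≤ s
    · rw [indicator_of_mem (show s ∈ Icc τ T from ⟨h, hs.2⟩)]
    · rw [indicator_of_notMem (fun h' => h h'.1), hq.past (s - τ) ⟨by linarith [hs.1], by linarith⟩,
        ContinuousLinearMap.zero_comp]
  have hG₁c : ContinuousOn (fun s => (q s).comp (A (P (T - s)))) (Icc 0 T) :=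
    hq.continuousOn.clm_comp hAc.continuousOn
  have hG₂c : ContinuousOn G₂ (Icc τ T) :=
    (hq.continuousOn.comp (by fun_prop) fun s hs => ⟨by linarith [hs.1], by linarith [hs.2]⟩).clm_comp
      hBc.continuousOn
  have hHi : IntegrableOn H (Icc 0 T) :=
    hG₁c.integrableOn_Icc.add
      ((integrable_indicator_iff measurableSet_Icc).2 hG₂c.integrableOn_Icc).integrableOn
  have hHii : ∀ s ∈ Icc 0 T, IntervalIntegrable H volume 0 s := fun s hs =>
    (intervalIntegrable_iff_integrableOn_Icc_of_le hs.1).2 (hHi.mono_set (Icc_subset_Icc_right hs.2))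
  have hHc : ∀ s ∈ Icc 0 T, s ≠ τ → ContinuousWithinAt H (Icc 0 T) s := by
    intro s hs hne
    refine (hG₁c s hs).add ?_
    rcases lt_or_gt_of_ne hne with h | h
    · refine (continuousWithinAt_const (b := (0 : E →L[ℝ] ℝ))).congr_of_eventuallyEq ?_
        (indicator_of_notMem (fun h' => absurd h'.1 (not_le.2 h)) _)
      filter_upwards [mem_nhdsWithin_of_mem_nhds (Iio_mem_nhds h)] with r hr
      exact indicator_of_notMem (fun h' => absurd h'.1 (not_le.2 hr)) _
    · have h1 : Icc τ T ∈ 𝓝[Icc 0 T] s := by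
        filter_upwards [mem_nhdsWithin_of_mem_nhds (Ioi_mem_nhds h), self_mem_nhdsWithin] with r hr hr'
        exact ⟨le_of_lt hr, hr'.2⟩
      refine ((hG₂c s ⟨h.le, hs.2⟩).mono_of_mem_nhdsWithin h1).congr_of_eventuallyEq ?_
        (indicator_of_mem (show s ∈ Icc τ T from ⟨h.le, hs.2⟩) _)
      filter_upwards [h1] with r hr
      exact indicator_of_mem hr _
  -- Writing `q` as an integral of `H` upgrades right derivatives to derivatives within `Icc 0 T`
  -- wherever `H` is continuous.
  have hqi : ∀ s ∈ Icc 0 T, q s = q 0 + ∫ r in (0 : ℝ)..s, H r := by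
    intro s hs
    rw [intervalIntegral.integral_eq_sub_of_hasDeriv_right_of_le hs.1
      (hq.continuousOn.mono (Icc_subset_Icc_right hs.2)) (fun r hr => ?_) (hHii s hs)]
    · abel
    · have h1 := hq.deriv r ⟨hr.1.le, hr.2.trans_le hs.2⟩
      rw [hvH r ⟨hr.1.le, hr.2.le.trans hs.2⟩] at h1
      exact h1.mono Ioi_subset_Ici_self
  have hqd : ∀ s ∈ Icc 0 T, s ≠ τ → HasDerivWithinAt q (H s) (Icc 0 T) s := by
    intro s hs hne
    have : Fact (s ∈ Icc 0 T) := ⟨hs⟩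
    have h1 := (intervalIntegral.integral_hasDerivWithinAt_right (hHii s hs) (s := Icc 0 T)
      (t := Icc 0 T) ⟨Icc 0 T, self_mem_nhdsWithin, hHi.aestronglyMeasurable⟩
      (hHc s hs hne)).const_add (q 0)
    exact h1.congr hqi (hqi s hs)
  have hsub : ∀ (S : Set ℝ) t, HasDerivWithinAt (fun r => T - r) (-1) S t := fun S t => by
    simpa using (hasDerivWithinAt_id t S).const_sub T
  refine ⟨fun t => q (T - t), fun t => -H (T - t), by simp [hq.start], ?_, ?_, ?_, ?_⟩
  · refine hq.continuousOn.comp (by fun_prop) fun s hs => ?_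
    constructor <;> linarith [hs.1, hs.2]
  · intro t ht
    have h1 : T - (T - t) = t := by ring
    simp only [hH, h1, hPe t ht]
    rw [neg_add']
    congr 1
    by_cases h : t ≤ T - τ
    · rw [indicator_of_mem (show T - t ∈ Icc τ T from ⟨by linarith, by linarith [ht.1]⟩),
        indicator_of_mem (show t ∈ Icc 0 (T - τ) from ⟨ht.1, h⟩)]
      simp only [hG₂, h1, hPe (t + τ) ⟨by linarith [ht.1], by linarith⟩, add_sub_cancel_right]
      rw [show T - t - τ = T - (t + τ) by ring]
    · rw [indicator_of_notMem fun h' => h (by linarith [h'.1]), indicator_of_notMem fun h' => h h'.2]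
  · intro t ht hne
    refine ((hqd (T - t) ⟨by linarith [ht.2], by linarith [ht.1]⟩ fun h => hne (by linarith)).scomp t
      (hsub _ t) fun r hr => ?_).congr_deriv (by simp)
    constructor <;> linarith [hr.1, hr.2]
  -- Time reversal turns the right derivative of `q`, valid even at `s = τ`, into the left
  -- derivative of `p`.
  · intro t ht
    have h1 := hq.deriv (T - t) ⟨by linarith [ht.2], by linarith [ht.1]⟩
    rw [hvH _ ⟨by linarith [ht.2], by linarith [ht.1]⟩] at h1
    refine (h1.scomp t (hsub _ t) fun r (hr : r ≤ t) => ?_).congr_deriv (by simp)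
    simp only [mem_Ici]
    linarith

open MeasureTheory in
theorem integral_eq_sub_of_hasDeriv_right_of_ne {f f' : ℝ → ℝ} {a b : ℝ} (hab : a ≤ b) (c : ℝ)
    (hcont : ContinuousOn f (Icc a b))
    (hderiv : ∀ x ∈ Ioo a b, x ≠ c → HasDerivWithinAt f (f' x) (Ioi x) x)
    (hint : IntervalIntegrable f' volume a b) : ∫ x in a..b, f' x = f b - f a := by
  by_cases hc : c ∈ Ioo a b
  · have h1 : IntervalIntegrable f' volume a c :=
      hint.mono_set (uIcc_subset_uIcc left_mem_uIcc (Icc_subset_uIcc (Ioo_subset_Icc_self hc)))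
    have h2 : IntervalIntegrable f' volume c b :=
      hint.mono_set (uIcc_subset_uIcc (Icc_subset_uIcc (Ioo_subset_Icc_self hc)) right_mem_uIcc)
    rw [← intervalIntegral.integral_add_adjacent_intervals h1 h2,
      intervalIntegral.integral_eq_sub_of_hasDeriv_right_of_le hc.1.le
        (hcont.mono (Icc_subset_Icc_right hc.2.le))
        (fun x hx => hderiv x ⟨hx.1, hx.2.trans hc.2⟩ hx.2.ne) h1,
      intervalIntegral.integral_eq_sub_of_hasDeriv_right_of_le hc.2.le
        (hcont.mono (Icc_subset_Icc_left hc.1.le))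
        (fun x hx => hderiv x ⟨hc.1.trans hx.1, hx.2⟩ hx.1.ne') h2]
    ring
  · exact intervalIntegral.integral_eq_sub_of_hasDeriv_right_of_le hab hcont
      (fun x hx => hderiv x hx fun h => hc (h ▸ hx)) hint

open MeasureTheory in
/-- The pairing of a solution of the backward delay equation with an approximate solution of the
linearized forward equation is approximately conserved. -/
theorem abs_apply_sub_apply_le_of_backward_solution {E : Type*} [NormedAddCommGroup E]
    [NormedSpace ℝ E] {A B : ℝ → E →L[ℝ] E} {p p' : ℝ → E →L[ℝ] ℝ} {δ δ' : ℝ → E}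
    {τ t T C r : ℝ} (hτ : 0 < τ) (ht : t ∈ Icc 0 T)
    (hB : ContinuousOn (fun s => B (s - τ)) (Icc 0 T)) (hp : ContinuousOn p (Icc 0 T))
    (hp' : ∀ s ∈ Icc 0 T, p' s = -((p s).comp (A s)) -
      (Icc 0 (T - τ)).indicator (fun s => (p (s + τ)).comp (B s)) s)
    (hpd : ∀ s ∈ Icc 0 T, s ≠ T - τ → HasDerivWithinAt p (p' s) (Icc 0 T) s)
    (hpC : ∀ s ∈ Icc 0 T, ‖p s‖ ≤ C)
    (hpast : ∀ s ∈ Ico (t - τ) t, δ s = 0) (hδ : ContinuousOn δ (Icc t T))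
    (hδd : ∀ s ∈ Ico t T, HasDerivWithinAt δ (δ' s) (Ici s) s)
    (hr : ∀ s ∈ Ico t T, ‖δ' s - (A s (δ s) + B (s - τ) (δ (s - τ)))‖ ≤ r) :
    |p T (δ T) - p t (δ t)| ≤ C * r * (T - t) := by
  have hsub : Icc t T ⊆ Icc 0 T := Icc_subset_Icc_left ht.1
  set V : ℝ → ℝ := fun s => p s (δ s) with hV
  set Q : ℝ → ℝ := fun s => p s (δ' s - (A s (δ s) + B (s - τ) (δ (s - τ)))) with hQ
  set J : ℝ → ℝ := (Icc (t + τ) T).indicator fun s => p s (B (s - τ) (δ (s - τ))) with hJ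
  have hVc : ContinuousOn V (Icc t T) := (hp.mono hsub).clm_apply hδ
  have hJi : Integrable J := by
    refine (integrable_indicator_iff measurableSet_Icc).2 (ContinuousOn.integrableOn_Icc ?_)
    have h1 : Icc (t + τ) T ⊆ Icc 0 T := Icc_subset_Icc_left (by linarith [ht.1])
    exact (hp.mono h1).clm_apply ((hB.mono h1).clm_apply
      (hδ.comp (by fun_prop) fun s hs => ⟨by linarith [hs.1], by linarith [hs.2]⟩))
  have hJi' : Integrable fun s => J (s + τ) := hJi.comp_add_right τ
  have hVd : ∀ s ∈ Ico t T, s ≠ T - τ →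
      HasDerivWithinAt V (Q s + (J s - J (s + τ))) (Ici s) s := by
    intro s hs hne
    have hs0 : s ∈ Icc 0 T := hsub ⟨hs.1, hs.2.le⟩
    have h1 : HasDerivWithinAt p (p' s) (Ici s) s :=
      (hpd s hs0 hne).mono_of_mem_nhdsWithin <|
        mem_of_superset (Icc_mem_nhdsGE hs.2) (Icc_subset_Icc_left hs0.1)
    refine (h1.clm_apply (hδd s hs)).congr_deriv ?_
    have h2 : J s = p s (B (s - τ) (δ (s - τ))) := by
      by_cases h : t + τ ≤ s
      · exact indicator_of_mem (show s ∈ Icc (t + τ) T from ⟨h, hs.2.le⟩) _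
      · rw [hJ, indicator_of_notMem fun h' => h h'.1,
          hpast (s - τ) ⟨by linarith [hs.1], by linarith⟩, map_zero, map_zero]
    have h3 : J (s + τ) =
        ((Icc 0 (T - τ)).indicator (fun s => (p (s + τ)).comp (B s)) s) (δ s) := by
      by_cases h : s ≤ T - τ
      · rw [hJ, indicator_of_mem (show s + τ ∈ Icc (t + τ) T from ⟨by linarith [hs.1], by linarith⟩),
          indicator_of_mem (show s ∈ Icc 0 (T - τ) from ⟨hs0.1, h⟩), add_sub_cancel_right,
          ContinuousLinearMap.comp_apply]
      · rw [hJ, indicator_of_notMem fun h' => h (by linarith [h'.2]),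
          indicator_of_notMem fun h' => h h'.2, zero_apply]
    rw [h2, h3, hp' s hs0]
    simp only [hQ, sub_apply, neg_apply,
      ContinuousLinearMap.comp_apply, map_sub, map_add]
    ring
  have hae : ∀ᵐ s : ℝ, s ∈ Ioc t T → s ∈ Ico t T ∧ s ≠ T - τ := by
    filter_upwards [compl_mem_ae_iff.2 (measure_singleton (T - τ)),
      compl_mem_ae_iff.2 (measure_singleton T)] with s h1 h2 hs
    exact ⟨⟨hs.1.le, lt_of_le_of_ne hs.2 h2⟩, h1⟩
  have hQle : ∀ s ∈ Ico t T, ‖Q s‖ ≤ C * r := fun s hs =>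
    ((p s).le_opNorm _).trans <| mul_le_mul (hpC s (hsub ⟨hs.1, hs.2.le⟩)) (hr s hs) (norm_nonneg _)
      ((norm_nonneg _).trans (hpC s (hsub ⟨hs.1, hs.2.le⟩)))
  have hQae : ∀ᵐ s : ℝ, s ∈ Ioc t T → ‖Q s‖ ≤ C * r :=
    hae.mono fun s h hs => hQle s (h hs).1
  -- No measurability of `δ'` is assumed; `Q` is almost everywhere the right derivative of `V` minus
  -- the measurable `J` terms.
  have hQi : IntegrableOn Q (Ioc t T) := by
    have hm : AEStronglyMeasurable Q (volume.restrict (Ioc t T)) := by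
      refine ((aestronglyMeasurable_derivWithin_Ici V _).sub
        (hJi.sub hJi').aestronglyMeasurable.restrict).congr ?_
      refine (ae_restrict_iff' measurableSet_Ioc).2 (hae.mono fun s h hs => ?_)
      have h1 := (hVd s (h hs).1 (h hs).2).derivWithin (uniqueDiffWithinAt_Ici s)
      simp only [Pi.sub_apply, h1]
      ring
    exact Integrable.of_bound hm (C * r) ((ae_restrict_iff' measurableSet_Ioc).2 hQae)
  have hQii : IntervalIntegrable Q volume t T :=
    (intervalIntegrable_iff_integrableOn_Ioc_of_le ht.2).2 hQi
  have hftc := integral_eq_sub_of_hasDeriv_right_of_ne ht.2 (T - τ) hVc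
    (fun s hs hne => (hVd s ⟨hs.1.le, hs.2⟩ hne).mono Ioi_subset_Ici_self)
    (hQii.add (hJi.intervalIntegrable.sub hJi'.intervalIntegrable))
  -- `J` lives on `Icc (t + τ) T` and its shift on `Icc t (T - τ)`, so both integrals are integrals
  -- over `ℝ`, equal by translation invariance.
  have hJe : ∫ s in t..T, J s = ∫ s in t..T, J (s + τ) := by
    have h1 : ∀ s ∉ Icc t T, J s = 0 := fun s hs =>
      indicator_of_notMem (fun h => hs ⟨by linarith [h.1], h.2⟩) _
    have h2 : ∀ s ∉ Icc t T, J (s + τ) = 0 := fun s hs =>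
      indicator_of_notMem (fun h => hs ⟨by linarith [h.1], by linarith [h.2]⟩) _
    rw [intervalIntegral.integral_of_le ht.2, intervalIntegral.integral_of_le ht.2,
      ← integral_Icc_eq_integral_Ioc, ← integral_Icc_eq_integral_Ioc,
      setIntegral_eq_integral_of_forall_compl_eq_zero h1,
      setIntegral_eq_integral_of_forall_compl_eq_zero h2, integral_add_right_eq_self J τ]
  rw [intervalIntegral.integral_add hQii (hJi.intervalIntegrable.sub hJi'.intervalIntegrable),
    intervalIntegral.integral_sub hJi.intervalIntegrable hJi'.intervalIntegrable, hJe, sub_self,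
    add_zero] at hftc
  have := intervalIntegral.norm_integral_le_of_norm_le_const_ae (C := C * r) (f := Q) (a := t)
    (b := T) (by rw [uIoc_of_le ht.2]; exact hQae)
  rwa [hftc, Real.norm_eq_abs, abs_of_nonneg (sub_nonneg.2 ht.2)] at this

/-! ### Identification of the backward solution with the adjoint. -/

theorem hasFDerivAt_terminalLoss {n m : ℕ} {f : Vec n → Vec n → ℝ → Vec m → Vec n} {w : Vec m}
    {τ T : ℝ} {φ h : ℝ → Vec n} (hτ : 0 < τ) (hf : IsC1Field fun x y t => f x y t w)
    (hh : IsForwardSolution f w τ T φ h) (hc : ContinuousOn h (Icc (-τ) T)) {L : Vec n → ℝ}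
    {p p' : ℝ → Vec n →L[ℝ] ℝ} (hL : HasFDerivAt L (p T) (h T)) (hp : ContinuousOn p (Icc 0 T))
    (hp' : ∀ s ∈ Icc 0 T, p' s = -((p s).comp (jacPresent f w τ h s)) -
      (Icc 0 (T - τ)).indicator (fun s => (p (s + τ)).comp (jacDelayed f w τ h s)) s)
    (hpd : ∀ s ∈ Icc 0 T, s ≠ T - τ → HasDerivWithinAt p (p' s) (Icc 0 T) s) {t : ℝ}
    (ht : t ∈ Icc 0 T) : HasFDerivAt (terminalLoss f w τ T L h t) (p t) (h t) := by
  have hT : 0 ≤ T := ht.1.trans ht.2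
  obtain ⟨C, hC, hres⟩ := exists_isRestart_norm_sub_le hf hh hc hτ hT
  obtain ⟨P, hP⟩ := isCompact_Icc.exists_bound_of_continuousOn hp
  obtain ⟨M, hM⟩ := isCompact_Icc.exists_bound_of_continuousOn hc
  have hP0 : 0 ≤ P := (norm_nonneg _).trans (hP t ht)
  have hloss : terminalLoss f w τ T L h t (h t) = L (h T) := by
    obtain ⟨y, hy, hyb⟩ := hres t ht (h t) (by simp)
    have h1 := hyb T (right_mem_Icc.2 ht.2)
    rw [sub_self, norm_zero, mul_zero] at h1
    rw [terminalLoss_eq hf hc hτ ht L hy, sub_eq_zero.1 (norm_le_zero_iff.1 h1)]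
  refine HasFDerivAt.of_isLittleO (Asymptotics.isLittleO_iff.2 fun ε hε => ?_)
  -- The error `ε` is split evenly between the expansion of `L` and the defect of the pairing; the
  -- `+ 1` in the next denominator covers `P * C * T = 0`.
  obtain ⟨r, hr, hrL⟩ := Metric.eventually_nhds_iff.1
    (Asymptotics.isLittleO_iff.1 hL.isLittleO (show 0 < ε / (2 * C) by positivity))
  obtain ⟨η, hη, hrem⟩ := hf.exists_remainder_le M T
    (show 0 < ε / (2 * (P * C * T + 1)) by positivity)
  have hev : ∀ a > 0, ∀ᶠ ξ in 𝓝 (h t), C * ‖ξ - h t‖ < a := fun a ha => by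
    have h1 : Tendsto (fun ξ => C * ‖ξ - h t‖) (𝓝 (h t)) (𝓝 (C * ‖h t - h t‖)) :=
      (by fun_prop : Continuous fun ξ => C * ‖ξ - h t‖).tendsto _
    rw [sub_self, norm_zero, mul_zero] at h1
    exact h1.eventually_lt_const ha
  filter_upwards [hev 1 one_pos, hev r hr, hev η hη] with ξ hξ1 hξr hξη
  obtain ⟨y, hy, hyb⟩ := hres t ht ξ hξ1.le
  have hpast : ∀ s ∈ Ico (t - τ) t, y s - h s = 0 := fun s hs => by rw [hy.past s hs, sub_self]
  have hyb' : ∀ s ∈ Icc (t - τ) T, ‖y s - h s‖ ≤ C * ‖ξ - h t‖ := by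
    intro s hs
    rcases lt_or_ge s t with h1 | h1
    · rw [hpast s ⟨hs.1, h1⟩, norm_zero]
      positivity
    · exact hyb s ⟨h1, hs.2⟩
  have hpair := abs_apply_sub_apply_le_of_backward_solution (δ := fun s => y s - h s) hτ ht
    (continuousOn_jac hf hc hτ).2 hp hp' hpd hP hpast
    (hy.continuousOn.sub (hc.mono (Icc_subset_Icc_left (by linarith [ht.1]))))
    (fun s hs => (hy.deriv s hs).sub (hh.hasDerivWithinAt_Ici ⟨ht.1.trans hs.1, hs.2⟩))
    (fun s hs => by
      have hs0 : s ∈ Icc 0 T := ⟨ht.1.trans hs.1, hs.2.le⟩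
      rw [← fderiv_apply_eq_jac hf hs0.1]
      exact hrem s hs0 _ _ _ _ _ hξη.le (hM s ⟨by linarith [hs0.1], hs0.2⟩)
        (hM (s - τ) ⟨by linarith [hs0.1], by linarith [hs0.2]⟩)
        (hyb' s ⟨by linarith [hs.1], hs.2.le⟩) (hyb' _ ⟨by linarith [hs.1], by linarith [hs.2]⟩))
  simp only [hy.start] at hpair
  have hyT := hyb T (right_mem_Icc.2 ht.2)
  have hLy := hrL (y := y T) (by rw [dist_eq_norm]; exact lt_of_le_of_lt hyT hξr)
  rw [terminalLoss_eq hf hc hτ ht L hy, hloss]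
  have hsplit : L (y T) - L (h T) - p t (ξ - h t) =
      (L (y T) - L (h T) - p T (y T - h T)) + (p T (y T - h T) - p t (ξ - h t)) := by ring
  have h1 : ε / (2 * C) * ‖y T - h T‖ ≤ ε / 2 * ‖ξ - h t‖ := by
    refine (mul_le_mul_of_nonneg_left hyT (by positivity)).trans_eq ?_
    field_simp
  have h2 : P * (ε / (2 * (P * C * T + 1)) * (C * ‖ξ - h t‖)) * (T - t) ≤ ε / 2 * ‖ξ - h t‖ := by
    have h3 : T - t ≤ T := by linarith [ht.1]
    refine (mul_le_mul_of_nonneg_left h3 (by positivity)).trans ?_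
    have h4 : P * (ε / (2 * (P * C * T + 1)) * (C * ‖ξ - h t‖)) * T =
        (P * C * T / (P * C * T + 1)) * (ε / 2 * ‖ξ - h t‖) := by
      field_simp
    rw [h4]
    refine mul_le_of_le_one_left (by positivity) ?_
    rw [div_le_one (by positivity)]
    linarith
  rw [hsplit]
  refine (norm_add_le _ _).trans ?_
  rw [Real.norm_eq_abs (p T (y T - h T) - p t (ξ - h t))]
  linarith

end NDDE

theorem theorem1 {n m : ℕ} (f : NDDE.Vec n → NDDE.Vec n → ℝ → NDDE.Vec m → NDDE.Vec n)
    (w : NDDE.Vec m) (τ T : ℝ) (hτ : 0 < τ) (hT : 0 ≤ T)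
    (hf : NDDE.IsC1Field (fun x y t => f x y t w))
    (φ h : ℝ → NDDE.Vec n) (hφ : ContinuousOn φ (Set.Icc (-τ) 0))
    (hh : NDDE.IsForwardSolution f w τ T φ h)
    (L : NDDE.Vec n → ℝ) (hL : DifferentiableAt ℝ L (h T)) :
    -- the adjoint is well defined: restarted trajectories exist, are unique, and the loss is
    -- differentiable in the state at time `t`
    (∀ t ∈ Set.Icc 0 T,
      (∀ᶠ ξ in nhds (h t), ∃ y, NDDE.IsRestart f w τ T h t ξ y) ∧
      (∀ ξ y z, NDDE.IsRestart f w τ T h t ξ y → NDDE.IsRestart f w τ T h t ξ z →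
        Set.EqOn y z (Set.Icc (t - τ) T)) ∧
      DifferentiableAt ℝ (NDDE.terminalLoss f w τ T L h t) (h t)) ∧
    -- the backward delay differential equation
    ContinuousOn (NDDE.adjoint f w τ T L h) (Set.Icc 0 T) ∧
    (∀ t ∈ Set.Icc 0 T, t ≠ T - τ →
      HasDerivWithinAt (NDDE.adjoint f w τ T L h)
        (NDDE.adjointRHS f w τ T h (NDDE.adjoint f w τ T L h) t) (Set.Icc 0 T) t) ∧
    (∀ t ∈ Set.Ioc 0 T,
      HasDerivWithinAt (NDDE.adjoint f w τ T L h)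
        (NDDE.adjointRHS f w τ T h (NDDE.adjoint f w τ T L h) t) (Set.Iic t) t) ∧
    -- the terminal condition
    NDDE.adjoint f w τ T L h T = fderiv ℝ L (h T) := by
  have hc := hh.continuousOn hφ hτ hT
  have hjac := NDDE.continuousOn_jac hf hc hτ
  obtain ⟨p, p', hpT, hp, hp', hpd, hpl⟩ :=
    NDDE.exists_backward_delay_solution hτ hT hjac.1 hjac.2 (fderiv ℝ L (h T))
  have hfd : ∀ t ∈ Set.Icc 0 T, HasFDerivAt (NDDE.terminalLoss f w τ T L h t) (p t) (h t) :=
    fun t ht => NDDE.hasFDerivAt_terminalLoss hτ hf hh hc (hpT ▸ hL.hasFDerivAt) hp hp' hpd ht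
  have had : ∀ t ∈ Set.Icc 0 T, NDDE.adjoint f w τ T L h t = p t := fun t ht => (hfd t ht).fderiv
  have hrhs : ∀ t ∈ Set.Icc 0 T,
      NDDE.adjointRHS f w τ T h (NDDE.adjoint f w τ T L h) t = p' t := by
    intro t ht
    rw [NDDE.adjointRHS, hp' t ht, had t ht]
    congr 1
    by_cases htT : t ∈ Set.Icc 0 (T - τ)
    · rw [Set.indicator_of_mem htT, Set.indicator_of_mem htT,
        had (t + τ) ⟨by linarith [htT.1], by linarith [htT.2]⟩]
    · rw [Set.indicator_of_notMem htT, Set.indicator_of_notMem htT]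
  refine ⟨fun t ht => ⟨?_, fun ξ y z hy hz => hy.eqOn hf hc hτ ht hz,
    (hfd t ht).differentiableAt⟩, hp.congr had, fun t ht hne => ?_, fun t ht => ?_, ?_⟩
  · obtain ⟨C, -, hres⟩ := NDDE.exists_isRestart_norm_sub_le hf hh hc hτ hT
    have h1 : Filter.Tendsto (fun ξ => C * ‖ξ - h t‖) (nhds (h t)) (nhds (C * ‖h t - h t‖)) :=
      (by fun_prop : Continuous fun ξ => C * ‖ξ - h t‖).tendsto _
    rw [sub_self, norm_zero, mul_zero] at h1
    filter_upwards [h1.eventually_lt_const one_pos] with ξ hξ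
    obtain ⟨y, hy, -⟩ := hres t ht ξ hξ.le
    exact ⟨y, hy⟩
  · rw [hrhs t ht]
    exact (hpd t ht hne).congr had (had t ht)
  · have ht' : t ∈ Set.Icc 0 T := Set.Ioc_subset_Icc_self ht
    rw [hrhs t ht']
    refine (hpl t ht).congr_of_eventuallyEq ?_ (had t ht')
    -- The adjoint is known to equal `p` only on `Icc 0 T`; since `0 < t`, this contains a left
    -- neighbourhood of `t`.
    filter_upwards [Icc_mem_nhdsLE ht.1] with s hs
    exact had s ⟨hs.1, hs.2.trans ht.2⟩
  · rw [had T (Set.right_mem_Icc.2 hT), hpT]
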